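/- **The pedal porism.** Let $\mathcal T$ be a (nondegenerate) triangle in the Euclidean plane with circumcircle $\mathcal C$, and let $D$ be a point lying neither on a side line of $\mathcal T$ nor on $\mathcal C$. For a triangle $\mathcal T'$ whose three feet of the perpendiculars from $D$ to its side lines are not collinear, the pedal circle of $\mathcal T'$ (with respect to $D$) is the circle through these three feet. "Side" always means the line through two vertices. A line is tangent to a nondegenerate conic if it is tangent to it at a point of its projective closure (so the asymptotes of a hyperbola count as tangents), and a triangle is circumscribed to a conic if its three sides are tangent to it. Then the pedal circle $\mathcal E_D$ of $\mathcal T$ exists, there is exactly one nondegenerate conic $\gamma_D$ having $D$ as a focus (a circle has its centre as focus) to which $\mathcal T$ is circumscribed (the inconic of $\mathcal T$ focused at $D$), and the following hold. 1. $(\mathcal C,\gamma_D)$ is a Poncelet pair for $n=3$: there is a triangle inscribed in $\mathcal C$ and circumscribed to $\gamma_D$; and whenever two different tangents to $\gamma_D$ through a point $P\in\mathcal C$ meet $\mathcal C$ again in points $Q\ne P$ and $R\ne P$, respectively, the points $P,Q,R$ are the vertices of a triangle circumscribed to $\gamma_D$. 2. A triangle inscribed in $\mathcal C$ has pedal circle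 $\mathcal E_D$ with respect to $D$ if and only if it is circumscribed to $\gamma_D$. 3. Construction of all these triangles. Let $P\in\mathcal C$, and suppose that the circle with diameter $[PD]$ meets $\mathcal E_D$ in two different points $X,Y$ and that the lines $PX$, $PY$ meet $\mathcal C$ again in points $Q\neq P$ and $R\ne P$, respectively (if $X=P$, the line $PX$ is understood as the tangent at $P$ to the circle with diameter $[PD]$, and likewise for $Y$). Then the line $QR$ is tangent to $\gamma_D$, the foot of the perpendicular from $D$ to $QR$ lies on $\mathcal E_D$, and $PQR$ is a triangle inscribed in $\mathcal C$, circumscribed to $\gamma_D$ and with pedal circle $\mathcal E_D$. Conversely, every triangle inscribed in $\mathcal C$ and circumscribed to $\gamma_D$ is obtained in this way, starting from any of its vertices $P$. -/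

import Mathlib

open scoped Matrix

/-- The Euclidean plane. -/
abbrev Plane : Type := EuclideanSpace ℝ (Fin 2)

/-- Homogeneous coordinates `(x : y : 1)` of a point of the plane. -/
def homCoord (P : Plane) : Fin 3 → ℝ := ![P 0, P 1, 1]

/-- A nondegenerate conic of the projective plane, given by an equation `vᵀ M v = 0` with `M` an
invertible symmetric matrix. Proportional matrices give the same conic. -/
structure Conic where
  mat : Matrix (Fin 3) (Fin 3) ℝ
  symm : mat.IsSymm
  det_ne_zero : mat.det ≠ 0

namespace Conic

/-- Two equations define the same conic. -/
def Same (γ γ' : Conic) : Prop := ∃ c : ℝ, c ≠ 0 ∧ γ'.mat = c • γ.mat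

/-- The left-hand side of the affine equation of the conic. -/
def eqn (γ : Conic) (P : Plane) : ℝ := homCoord P ⬝ᵥ (γ.mat *ᵥ homCoord P)

/-- `ℓ` is a tangent line: it is the polar line `{w | vᵀ M w = 0}` of a point `v` of the projective
conic. The point of contact may be at infinity, so the asymptotes of a hyperbola are tangents. -/
def IsTangentLine (γ : Conic) (ℓ : AffineSubspace ℝ Plane) : Prop :=
  ∃ v : Fin 3 → ℝ, v ≠ 0 ∧ v ⬝ᵥ (γ.mat *ᵥ v) = 0 ∧
    ∀ P : Plane, P ∈ ℓ ↔ v ⬝ᵥ (γ.mat *ᵥ homCoord P) = 0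

/-- `F` is a focus: up to a scalar, the equation of the conic is the focus-directrix equation
`dist P F ^ 2 = (⟪u, P⟫ + k) ^ 2`. If `u ≠ 0` the directrix is the line `⟪u, P⟫ + k = 0`, which does
not contain `F`, and the eccentricity is `‖u‖`, because `|⟪u, P⟫ + k|` is `‖u‖` times the distance
from `P` to that line; if `u = 0` the conic is the circle with centre `F` and radius `|k| > 0`. -/
def IsFocus (γ : Conic) (F : Plane) : Prop :=
  ∃ (c : ℝ) (u : Plane) (k : ℝ), c ≠ 0 ∧ inner ℝ u F + k ≠ 0 ∧
    ∀ P : Plane, γ.eqn P = c * (dist P F ^ 2 - (inner ℝ u P + k) ^ 2)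

end Conic

/-- The side line of the triangle opposite to the vertex `i`. -/
noncomputable def sideLine (T : Affine.Triangle ℝ Plane) (i : Fin 3) : AffineSubspace ℝ Plane :=
  line[ℝ, T.points (i + 1), T.points (i + 2)]

/-- The foot of the perpendicular from `D` to the line through `A` and `B`. -/
noncomputable def footOn (D A B : Plane) : Plane :=
  (EuclideanGeometry.orthogonalProjection line[ℝ, A, B] D : Plane)

/-- The vertices of the pedal triangle of `T` with respect to `D`. -/
noncomputable def pedalPoints (D : Plane) (T : Affine.Triangle ℝ Plane) : Fin 3 → Plane :=
  fun i => footOn D (T.points (i + 1)) (T.points (i + 2))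

/-- `E` is the circumcircle of the (nondegenerate) pedal triangle of `T` with respect to `D`. -/
def IsPedalCircle (D : Plane) (T : Affine.Triangle ℝ Plane)
    (E : EuclideanGeometry.Sphere Plane) : Prop :=
  ∃ h : AffineIndependent ℝ (pedalPoints D T),
    (Affine.Simplex.mk (n := 2) (pedalPoints D T) h).circumsphere = E

/-- The triangle is inscribed in the circle. -/
def IsInscribedIn (T : Affine.Triangle ℝ Plane) (C : EuclideanGeometry.Sphere Plane) : Prop :=
  ∀ i, T.points i ∈ C

/-- The triangle is circumscribed to the conic: its side lines are tangents of the conic. -/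
def IsCircumscribedTo (T : Affine.Triangle ℝ Plane) (γ : Conic) : Prop :=
  ∀ i, γ.IsTangentLine (sideLine T i)

/-- `γ` is an inconic of `T` with focus `D`. -/
def IsInconicWithFocus (γ : Conic) (T : Affine.Triangle ℝ Plane) (D : Plane) : Prop :=
  γ.IsFocus D ∧ IsCircumscribedTo T γ

/-- `(C, γ)` is a Poncelet (poristic) pair for `n = 3`: some triangle is inscribed in `C` and
circumscribed to `γ`, and the construction closes up after three steps from every starting point:
if two different tangents to `γ` through a point `P` of `C` meet `C` again in `Q` and `R`, then
`P`, `Q`, `R` are the vertices of a triangle circumscribed to `γ`. -/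
def IsPonceletPairThree (C : EuclideanGeometry.Sphere Plane) (γ : Conic) : Prop :=
  (∃ T : Affine.Triangle ℝ Plane, IsInscribedIn T C ∧ IsCircumscribedTo T γ) ∧
  ∀ (P Q R : Plane) (ℓ₁ ℓ₂ : AffineSubspace ℝ Plane),
    P ∈ C → Q ∈ C → R ∈ C →
    γ.IsTangentLine ℓ₁ → γ.IsTangentLine ℓ₂ → ℓ₁ ≠ ℓ₂ →
    P ∈ ℓ₁ → P ∈ ℓ₂ → Q ∈ ℓ₁ → R ∈ ℓ₂ → Q ≠ P → R ≠ P →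
    ∃ T : Affine.Triangle ℝ Plane, T.points = ![P, Q, R] ∧ IsCircumscribedTo T γ

open Classical in
/-- For a point `X` of the circle with diameter `[PD]`, the line `PX`; in the limiting case `X = P`
this is the tangent to that circle at `P`. -/
noncomputable def lineFrom (D P X : Plane) : AffineSubspace ℝ Plane :=
  if X = P then (EuclideanGeometry.Sphere.ofDiameter P D).orthRadius P else line[ℝ, P, X]

/-- The triple `P, Q, R` is produced by the pedal construction started at the point `P` of the
circle `C`: the circle with diameter `[PD]` meets `E` in two different points `X`, `Y`, and the
lines `PX`, `PY` meet `C` again in `Q` and `R`. -/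
def IsPedalConstruction (C E : EuclideanGeometry.Sphere Plane) (D P Q R : Plane) : Prop :=
  P ∈ C ∧ ∃ X Y : Plane, X ≠ Y ∧
    X ∈ E ∧ X ∈ EuclideanGeometry.Sphere.ofDiameter P D ∧
    Y ∈ E ∧ Y ∈ EuclideanGeometry.Sphere.ofDiameter P D ∧
    Q ∈ C ∧ Q ≠ P ∧ Q ∈ lineFrom D P X ∧
    R ∈ C ∧ R ≠ P ∧ R ∈ lineFrom D P Y

open EuclideanGeometry
open scoped ComplexConjugate RealInnerProductSpace

/-! The feet of the perpendiculars from a focus `D` to the tangents of a conic lie on its pedal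
curve, which determines the conic; when this curve is a circle `E`, a line is tangent to the conic
if and only if the foot of `D` on it lies on `E`. Hence inconics with focus `D` correspond to pedal
circles, and the closing property only concerns feet on chords of the circumcircle.

Take the circumcircle as the unit circle of the complex plane, and let `μ` be the isogonal conjugate
of `D = d` with respect to the triangle. The foot on the chord from `a` to `b` is
`(d + a + b - a * b * conj d) / 2`; the pedal circle is centred at the midpoint of `d` and `μ`, and
the foot lies on it if and only if `B a = B b`, where `B` is the Blaschke product of degree three
with zeros `0`, `d` and `μ`. So the porism is the transitivity of equality. -/

section Hyperplane

variable {V P : Type*} [NormedAddCommGroup V] [InnerProductSpace ℝ V] [MetricSpace P]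
  [NormedAddTorsor V P] {A B D Q X : P}

/-- The hyperplane on which the foot of the perpendicular from `D` is `X`; it is the whole space if
`X = D`. Only the centre of the sphere matters for `orthRadius`, so the radius `0` is arbitrary. -/
noncomputable def hyperplaneWithFoot (D X : P) : AffineSubspace ℝ P :=
  (⟨D, 0⟩ : Sphere P).orthRadius X

theorem mem_hyperplaneWithFoot : Q ∈ hyperplaneWithFoot D X ↔ ⟪X -ᵥ D, Q -ᵥ X⟫ = 0 :=
  Sphere.mem_orthRadius_iff_inner_right

theorem self_mem_hyperplaneWithFoot (D X : P) : X ∈ hyperplaneWithFoot D X :=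
  Sphere.self_mem_orthRadius _ X

theorem hyperplaneWithFoot_injective (D : P) : Function.Injective (hyperplaneWithFoot D) :=
  Sphere.orthRadius_injective _

theorem mem_hyperplaneWithFoot_iff_inner_vsub :
    Q ∈ hyperplaneWithFoot D X ↔ ⟪X -ᵥ D, Q -ᵥ D⟫ = ‖X -ᵥ D‖ ^ 2 := by
  rw [mem_hyperplaneWithFoot, ← vsub_sub_vsub_cancel_right Q X D, inner_sub_right,
    real_inner_self_eq_norm_sq, sub_eq_zero]

theorem mem_ofDiameter_iff_mem_hyperplaneWithFoot :
    X ∈ Sphere.ofDiameter Q D ↔ Q ∈ hyperplaneWithFoot D X := by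
  rw [← Sphere.angle_eq_pi_div_two_iff_mem_sphere_ofDiameter, EuclideanGeometry.angle,
    ← InnerProductGeometry.inner_eq_zero_iff_angle_eq_pi_div_two, mem_hyperplaneWithFoot,
    ← neg_vsub_eq_vsub_rev D X, inner_neg_left, neg_eq_zero, real_inner_comm]

theorem orthRadius_ofDiameter_left (Q D : P) :
    (Sphere.ofDiameter Q D).orthRadius Q = hyperplaneWithFoot D Q := by
  ext R
  rw [Sphere.mem_orthRadius_iff_inner_right, mem_hyperplaneWithFoot, Sphere.ofDiameter,
    left_vsub_midpoint, real_inner_smul_left]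
  simp

theorem line_eq_hyperplaneWithFoot [Fact (Module.finrank ℝ V = 2)] (hX : X ≠ D) (hAB : A ≠ B)
    (hA : A ∈ hyperplaneWithFoot D X) (hB : B ∈ hyperplaneWithFoot D X) :
    line[ℝ, A, B] = hyperplaneWithFoot D X := by
  have hdim : Module.finrank ℝ V = 2 := Fact.out
  have : FiniteDimensional ℝ V := .of_finrank_pos (by omega)
  have hle : line[ℝ, A, B] ≤ hyperplaneWithFoot D X := affineSpan_pair_le_of_mem_of_mem hA hB
  refine AffineSubspace.eq_of_direction_eq_of_nonempty_of_le
    (Submodule.eq_of_le_of_finrank_eq (AffineSubspace.direction_le hle) ?_)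
    ⟨A, left_mem_affineSpan_pair ℝ A B⟩ hle
  have hfoot : Module.finrank ℝ (hyperplaneWithFoot D X).direction + 1 = Module.finrank ℝ V :=
    Sphere.finrank_orthRadius hX
  rw [direction_affineSpan, vectorSpan_pair, finrank_span_singleton (vsub_ne_zero.2 hAB)]
  omega

theorem eq_zero_of_forall_inner_vsub_eq {s : Set P} (hs : affineSpan ℝ s = ⊤) {n : V} {c : ℝ}
    (h : ∀ X ∈ s, ⟪n, X -ᵥ D⟫ = c) : n = 0 ∧ c = 0 := by
  obtain ⟨X₀, hX₀⟩ := AffineSubspace.nonempty_of_affineSpan_eq_top ℝ V P hs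
  have hle : vectorSpan ℝ s ≤ (ℝ ∙ n)ᗮ := by
    rw [vectorSpan_def, Submodule.span_le]
    rintro _ ⟨X, hX, Y, hY, rfl⟩
    rw [SetLike.mem_coe, Submodule.mem_orthogonal_singleton_iff_inner_right]
    beta_reduce
    rw [← vsub_sub_vsub_cancel_right X Y D, inner_sub_right, h X hX, h Y hY, sub_self]
  rw [AffineSubspace.vectorSpan_eq_top_of_affineSpan_eq_top ℝ V P hs] at hle
  obtain rfl : n = 0 := inner_self_eq_zero.1 <|
    Submodule.mem_orthogonal_singleton_iff_inner_right.1 (hle Submodule.mem_top)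
  exact ⟨rfl, by rw [← h X₀ hX₀, inner_zero_left]⟩

end Hyperplane

section PedalCurve

variable {V P : Type*} [NormedAddCommGroup V] [InnerProductSpace ℝ V] [MetricSpace P]
  [NormedAddTorsor V P] {D Q X : P} {u : V} {e : ℝ} {E : Sphere P}

/-- The locus of the feet of the perpendiculars from `D` to the tangents of the conic
`dist Q D ^ 2 = (⟪u, Q -ᵥ D⟫ + e) ^ 2`. -/
def pedalCurve (D : P) (u : V) (e : ℝ) : Set P :=
  {X | e ^ 2 + 2 * e * ⟪u, X -ᵥ D⟫ = (1 - ‖u‖ ^ 2) * ‖X -ᵥ D‖ ^ 2}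

theorem mem_pedalCurve :
    X ∈ pedalCurve D u e ↔ e ^ 2 + 2 * e * ⟪u, X -ᵥ D⟫ = (1 - ‖u‖ ^ 2) * ‖X -ᵥ D‖ ^ 2 :=
  Iff.rfl

theorem ne_of_mem_pedalCurve (he : e ≠ 0) (hX : X ∈ pedalCurve D u e) : X ≠ D := by
  rintro rfl
  simp [mem_pedalCurve, he] at hX

theorem mem_pedalCurve_iff_norm_eq_one (hX : X ≠ D) :
    X ∈ pedalCurve D u e ↔ ‖u + (e / ‖X -ᵥ D‖ ^ 2) • (X -ᵥ D)‖ = 1 := by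
  have hN : ‖X -ᵥ D‖ ≠ 0 := norm_ne_zero_iff.2 (vsub_ne_zero.2 hX)
  rw [← sq_eq_sq₀ (norm_nonneg _) zero_le_one, norm_add_sq_real, real_inner_smul_right, norm_smul,
    mul_pow, Real.norm_eq_abs, sq_abs, mem_pedalCurve]
  field_simp
  constructor <;> intro h <;> linear_combination h

theorem mem_hyperplaneWithFoot_iff_inner_smul_vsub (he : e ≠ 0) (hX : X ≠ D) :
    Q ∈ hyperplaneWithFoot D X ↔ ⟪(e / ‖X -ᵥ D‖ ^ 2) • (X -ᵥ D), Q -ᵥ D⟫ = e := by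
  have hN : ‖X -ᵥ D‖ ≠ 0 := norm_ne_zero_iff.2 (vsub_ne_zero.2 hX)
  rw [mem_hyperplaneWithFoot_iff_inner_vsub, real_inner_smul_left]
  field_simp

theorem exists_smul_vsub_eq (D : P) (he : e ≠ 0) {n : V} (hn : n ≠ 0) :
    ∃ X, X ≠ D ∧ (e / ‖X -ᵥ D‖ ^ 2) • (X -ᵥ D) = n := by
  have hN : ‖n‖ ≠ 0 := norm_ne_zero_iff.2 hn
  refine ⟨(e / ‖n‖ ^ 2) • n +ᵥ D, ?_, ?_⟩
  · rw [← vsub_ne_zero, vadd_vsub]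
    exact smul_ne_zero (div_ne_zero he (pow_ne_zero 2 hN)) hn
  · rw [vadd_vsub, norm_smul, mul_pow, Real.norm_eq_abs, sq_abs, smul_smul]
    convert one_smul ℝ n
    field_simp

theorem power_eq_norm_sub_sq (E : Sphere P) (D X : P) :
    E.power X = ‖X -ᵥ D‖ ^ 2 + 2 * ⟪D -ᵥ E.center, X -ᵥ D⟫ + E.power D := by
  rw [Sphere.power, Sphere.power, dist_eq_norm_vsub V, dist_eq_norm_vsub V,
    ← vsub_add_vsub_cancel X D E.center, norm_add_sq_real, real_inner_comm]
  ring

theorem mem_pedalCurve_iff_mem_sphere (hr : 0 < E.radius) (hD : D ∉ E) :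
    X ∈ pedalCurve D (E.radius⁻¹ • (D -ᵥ E.center)) (E.power D / E.radius) ↔ X ∈ E := by
  have hpow : E.power D ≠ 0 := (Sphere.power_eq_zero_iff_mem_sphere hr.le).not.2 hD
  have hcenter : ‖D -ᵥ E.center‖ ^ 2 = E.power D + E.radius ^ 2 := by
    rw [Sphere.power, dist_eq_norm_vsub V, sub_add_cancel]
  rw [← Sphere.power_eq_zero_iff_mem_sphere hr.le, power_eq_norm_sub_sq E D X, mem_pedalCurve,
    norm_smul, mul_pow, hcenter, real_inner_smul_left, norm_inv, inv_pow, Real.norm_eq_abs, sq_abs]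
  field_simp
  refine ⟨fun h => mul_left_cancel₀ hpow ?_, fun h => ?_⟩
  · linear_combination h
  · linear_combination E.power D * h

/-- Proportional equations of the sphere and of the pedal curve leave only the sign undetermined. -/
theorem eq_or_eq_neg_of_subset_pedalCurve {s : Set P} (hs : affineSpan ℝ s = ⊤)
    (hsE : ∀ X ∈ s, X ∈ E) (hsu : s ⊆ pedalCurve D u e) (he : e ≠ 0) :
    (u = E.radius⁻¹ • (D -ᵥ E.center) ∧ e = E.power D / E.radius) ∨
      (u = -(E.radius⁻¹ • (D -ᵥ E.center)) ∧ e = -(E.power D / E.radius)) := by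
  set δ : ℝ := 1 - ‖u‖ ^ 2 with hδ
  obtain ⟨hcenter, hpower⟩ :
      e • u + δ • (D -ᵥ E.center) = 0 ∧ -(e ^ 2 + δ * E.power D) / 2 = 0 := by
    refine eq_zero_of_forall_inner_vsub_eq (D := D) hs fun X hX => ?_
    have hXE : E.power X = 0 := by
      rw [Sphere.power, mem_sphere.1 (hsE X hX), sub_self]
    have hXu := mem_pedalCurve.1 (hsu hX)
    rw [power_eq_norm_sub_sq E D X] at hXE
    rw [inner_add_left, real_inner_smul_left, real_inner_smul_left]
    linear_combination hXu / 2 + δ / 2 * hXE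
  have hδ0 : δ ≠ 0 := by
    intro h
    rw [h] at hpower
    exact he (pow_eq_zero_iff two_ne_zero |>.1 (by linear_combination -2 * hpower))
  have hsq : e ^ 2 = (δ * E.radius) ^ 2 := by
    have hnorm : e ^ 2 * ‖u‖ ^ 2 = δ ^ 2 * ‖D -ᵥ E.center‖ ^ 2 := by
      have := congrArg (‖·‖ ^ 2) (eq_neg_of_add_eq_zero_left hcenter)
      simpa only [norm_neg, norm_smul, mul_pow, Real.norm_eq_abs, sq_abs] using this
    rw [Sphere.power, dist_eq_norm_vsub V] at hpower
    linear_combination (-e ^ 2) * hδ + hnorm - 2 * δ * hpower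
  have hparam : ∀ ρ : ℝ, e = δ * ρ → u = -(ρ⁻¹ • (D -ᵥ E.center)) ∧ e = -(E.power D / ρ) := by
    rintro ρ rfl
    have hρ : ρ ≠ 0 := right_ne_zero_of_mul he
    constructor
    · rw [mul_smul, ← smul_add, smul_eq_zero_iff_right hδ0] at hcenter
      rw [eq_neg_of_add_eq_zero_right hcenter, smul_neg, inv_smul_smul₀ hρ, neg_neg]
    · field_simp
      refine mul_left_cancel₀ hδ0 ?_
      linear_combination -2 * hpower
  rcases sq_eq_sq_iff_eq_or_eq_neg.1 hsq with h | h
  · exact .inr (hparam E.radius h)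
  · left
    have := hparam (-E.radius) (by rw [h, mul_neg])
    rwa [inv_neg, neg_smul, neg_neg, div_neg, neg_neg] at this

end PedalCurve

section FocalConic

variable {D F u : Plane} {e : ℝ} {ℓ : AffineSubspace ℝ Plane} {γ γ' : Conic}

theorem inner_eq_mul_add_mul (u v : Plane) : ⟪u, v⟫ = u 0 * v 0 + u 1 * v 1 := by
  rw [PiLp.inner_apply, Fin.sum_univ_two, Real.inner_apply, Real.inner_apply]

/-- Homogeneous coordinates with respect to the origin `D`: for `t ≠ 0` this is the point
`D + t⁻¹ • z`, for `t = 0` the point at infinity in the direction `z`. -/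
def homCoordFrom (D z : Plane) (t : ℝ) : Fin 3 → ℝ := ![z 0 + t * D 0, z 1 + t * D 1, t]

theorem homCoordFrom_vsub_one (D P : Plane) : homCoordFrom D (P -ᵥ D) 1 = homCoord P := by
  simp [homCoordFrom, homCoord]

theorem exists_homCoordFrom_eq (D : Plane) (v : Fin 3 → ℝ) : ∃ z t, homCoordFrom D z t = v := by
  refine ⟨!₂[v 0 - v 2 * D 0, v 1 - v 2 * D 1], v 2, ?_⟩
  ext i
  fin_cases i <;> simp [homCoordFrom]

theorem homCoordFrom_eq_zero {z : Plane} {t : ℝ} : homCoordFrom D z t = 0 ↔ z = 0 ∧ t = 0 := by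
  constructor
  · intro h
    obtain rfl : t = 0 := congrFun h 2
    refine ⟨?_, rfl⟩
    ext i
    fin_cases i
    · simpa [homCoordFrom] using congrFun h 0
    · simpa [homCoordFrom] using congrFun h 1
  · rintro ⟨rfl, rfl⟩
    simp [homCoordFrom]

/-- The linear forms `x - D₀`, `y - D₁` and `⟪u, · - D⟫ + e`, homogenized; the pull-back of
`x ^ 2 + y ^ 2 - z ^ 2` along them is the conic with focus `D`. -/
noncomputable def focalFrame (D u : Plane) (e : ℝ) : Matrix (Fin 3) (Fin 3) ℝ :=
  !![1, 0, -D 0; 0, 1, -D 1; u 0, u 1, e - ⟪u, D⟫]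

theorem det_focalFrame (D u : Plane) (e : ℝ) : (focalFrame D u e).det = e := by
  rw [focalFrame, Matrix.det_fin_three, inner_eq_mul_add_mul]
  simp only [Matrix.of_apply, Matrix.cons_val', Matrix.cons_val]
  ring

/-- The conic `dist P D ^ 2 = (⟪u, P -ᵥ D⟫ + e) ^ 2` with focus `D`. -/
noncomputable def focalConic (D u : Plane) (e : ℝ) (he : e ≠ 0) : Conic where
  mat := (focalFrame D u e)ᵀ * Matrix.diagonal ![1, 1, -1] * focalFrame D u e
  symm := by
    rw [Matrix.IsSymm, Matrix.transpose_mul, Matrix.transpose_mul, Matrix.transpose_transpose,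
      Matrix.diagonal_transpose, Matrix.mul_assoc]
  det_ne_zero := by
    simp [Matrix.det_mul, Matrix.det_diagonal, Fin.prod_univ_three, det_focalFrame, he]

theorem focalFrame_mulVec (D u z : Plane) (e t : ℝ) :
    focalFrame D u e *ᵥ homCoordFrom D z t = ![z 0, z 1, ⟪u, z⟫ + t * e] := by
  ext i
  rw [Matrix.mulVec, dotProduct, Fin.sum_univ_three]
  fin_cases i <;>
    simp only [focalFrame, homCoordFrom, inner_eq_mul_add_mul, Matrix.of_apply, Matrix.cons_val',
      Matrix.cons_val, Fin.mk_zero, Fin.mk_one, Fin.reduceFinMk, Fin.isValue] <;>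
    ring

theorem dotProduct_focalConic_mulVec (he : e ≠ 0) (z w : Plane) (s t : ℝ) :
    homCoordFrom D z s ⬝ᵥ ((focalConic D u e he).mat *ᵥ homCoordFrom D w t) =
      ⟪z, w⟫ - (⟪u, z⟫ + s * e) * (⟪u, w⟫ + t * e) := by
  rw [focalConic, ← Matrix.mulVec_mulVec, ← Matrix.mulVec_mulVec, Matrix.dotProduct_mulVec,
    Matrix.vecMul_transpose, focalFrame_mulVec, focalFrame_mulVec, inner_eq_mul_add_mul z w]
  simp only [Matrix.mulVec_diagonal, dotProduct, Fin.sum_univ_three, Matrix.cons_val]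
  ring

theorem eqn_focalConic (he : e ≠ 0) (P : Plane) :
    (focalConic D u e he).eqn P = dist P D ^ 2 - (⟪u, P -ᵥ D⟫ + e) ^ 2 := by
  rw [Conic.eqn, ← homCoordFrom_vsub_one D P, dotProduct_focalConic_mulVec,
    real_inner_self_eq_norm_sq, dist_eq_norm_vsub Plane]
  ring

/-- Six points suffice to determine the six coefficients. -/
theorem eq_of_isSymm_of_forall_homCoord {M N : Matrix (Fin 3) (Fin 3) ℝ} (hM : M.IsSymm)
    (hN : N.IsSymm)
    (h : ∀ P : Plane, homCoord P ⬝ᵥ (M *ᵥ homCoord P) = homCoord P ⬝ᵥ (N *ᵥ homCoord P)) :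
    M = N := by
  have hval (x y : ℝ) := h !₂[x, y]
  simp only [homCoord, Matrix.mulVec, dotProduct, Fin.sum_univ_three, Matrix.cons_val,
    hM.apply 0 1, hM.apply 0 2, hM.apply 1 2, hN.apply 0 1, hN.apply 0 2, hN.apply 1 2] at hval
  have h₀ := hval 0 0
  have h₁ := hval 1 0
  have h₂ := hval (-1) 0
  have h₃ := hval 0 1
  have h₄ := hval 0 (-1)
  have h₅ := hval 1 1
  ext i j
  fin_cases i <;> fin_cases j <;>
    simp only [Fin.mk_zero, Fin.mk_one, Fin.reduceFinMk, Fin.isValue, hM.apply 0 1, hM.apply 0 2,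
      hM.apply 1 2, hN.apply 0 1, hN.apply 0 2, hN.apply 1 2] <;>
    linarith

theorem focalConic_neg (he : e ≠ 0) :
    focalConic D (-u) (-e) (neg_ne_zero.2 he) = focalConic D u e he := by
  have hmat : (focalConic D (-u) (-e) (neg_ne_zero.2 he)).mat = (focalConic D u e he).mat := by
    refine eq_of_isSymm_of_forall_homCoord (Conic.symm _) (Conic.symm _) fun P => ?_
    rw [← Conic.eqn, ← Conic.eqn, eqn_focalConic, eqn_focalConic, inner_neg_left]
    ring
  cases h : focalConic D u e he
  cases h' : focalConic D (-u) (-e) (neg_ne_zero.2 he)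
  simpa only [h, h', Conic.mk.injEq] using hmat

theorem Conic.isFocus_iff_exists_same :
    γ.IsFocus F ↔ ∃ u e, ∃ he : e ≠ 0, (focalConic F u e he).Same γ := by
  constructor
  · rintro ⟨c, u, k, hc, hk, hγ⟩
    refine ⟨u, ⟪u, F⟫ + k, hk, c, hc,
      eq_of_isSymm_of_forall_homCoord γ.symm ((focalConic F u _ hk).symm.smul c) fun P => ?_⟩
    rw [Matrix.smul_mulVec, dotProduct_smul, smul_eq_mul, ← Conic.eqn, ← Conic.eqn, hγ P,
      eqn_focalConic, vsub_eq_sub, inner_sub_right]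
    ring
  · rintro ⟨u, e, he, c, hc, hγ⟩
    refine ⟨c, u, e - ⟪u, F⟫, hc, by rwa [add_sub_cancel], fun P => ?_⟩
    rw [Conic.eqn, hγ, Matrix.smul_mulVec, dotProduct_smul, smul_eq_mul, ← Conic.eqn,
      eqn_focalConic, vsub_eq_sub, inner_sub_right]
    ring

theorem Conic.Same.isTangentLine_iff (h : γ.Same γ') :
    γ'.IsTangentLine ℓ ↔ γ.IsTangentLine ℓ := by
  obtain ⟨c, hc, hmat⟩ := h
  simp only [Conic.IsTangentLine, hmat, Matrix.smul_mulVec, dotProduct_smul, smul_eq_mul,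
    mul_eq_zero, hc, false_or]

/-- The tangents are the polars of the points at which the factors `‖z‖` and `⟪u, z⟫ + t * e` of the
equation agree up to sign; scaling by the second one gives the unit vector `a`. -/
theorem isTangentLine_focalConic_iff_exists_norm_eq_one (he : e ≠ 0) :
    (focalConic D u e he).IsTangentLine ℓ ↔
      ∃ a : Plane, ‖a‖ = 1 ∧ ∀ P, P ∈ ℓ ↔ ⟪a - u, P -ᵥ D⟫ = e := by
  constructor
  · rintro ⟨v, hv, hvv, hℓ⟩
    obtain ⟨z, t, rfl⟩ := exists_homCoordFrom_eq D v
    rw [dotProduct_focalConic_mulVec, real_inner_self_eq_norm_sq] at hvv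
    set σ := ⟪u, z⟫ + t * e with hσ
    have hσ0 : σ ≠ 0 := by
      intro h0
      obtain rfl : z = 0 := by simpa [h0] using hvv
      exact hv (homCoordFrom_eq_zero.2 ⟨rfl, by simpa [hσ, he] using h0⟩)
    refine ⟨σ⁻¹ • z, ?_, fun P => ?_⟩
    · rw [← sq_eq_sq₀ (norm_nonneg _) zero_le_one, norm_smul, mul_pow, norm_inv, inv_pow,
        Real.norm_eq_abs, sq_abs]
      field_simp
      linear_combination hvv
    · rw [hℓ, ← homCoordFrom_vsub_one D P, dotProduct_focalConic_mulVec, inner_sub_left,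
        real_inner_smul_left, ← hσ]
      field_simp
      constructor <;> intro h <;> linear_combination h
  · rintro ⟨a, ha, hℓ⟩
    set t := (1 - ⟪u, a⟫) / e with ht
    have hσ : ⟪u, a⟫ + t * e = 1 := by rw [ht, div_mul_cancel₀ _ he, add_sub_cancel]
    refine ⟨homCoordFrom D a t, ?_, ?_, fun P => ?_⟩
    · rw [ne_eq, homCoordFrom_eq_zero]
      rintro ⟨rfl, -⟩
      simp at ha
    · rw [dotProduct_focalConic_mulVec, hσ, real_inner_self_eq_norm_sq, ha]
      norm_num
    · rw [hℓ, ← homCoordFrom_vsub_one D P, dotProduct_focalConic_mulVec, hσ, inner_sub_left]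
      constructor <;> intro h <;> linear_combination h

theorem isTangentLine_focalConic_iff (he : e ≠ 0) (hℓ : (ℓ : Set Plane).Nonempty) :
    (focalConic D u e he).IsTangentLine ℓ ↔
      ∃ X ∈ pedalCurve D u e, ℓ = hyperplaneWithFoot D X := by
  rw [isTangentLine_focalConic_iff_exists_norm_eq_one]
  constructor
  · rintro ⟨a, ha, hmem⟩
    have hn : a - u ≠ 0 := by
      obtain ⟨A, hA⟩ := hℓ
      intro hn
      have := (hmem A).1 hA
      rw [hn, inner_zero_left] at this
      exact he this.symm
    obtain ⟨X, hX, hXn⟩ := exists_smul_vsub_eq D he hn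
    refine ⟨X, ?_, ?_⟩
    · rw [mem_pedalCurve_iff_norm_eq_one hX, hXn, add_sub_cancel, ha]
    · ext P
      rw [hmem, mem_hyperplaneWithFoot_iff_inner_smul_vsub he hX, hXn]
  · rintro ⟨X, hXu, rfl⟩
    have hX := ne_of_mem_pedalCurve he hXu
    refine ⟨_, (mem_pedalCurve_iff_norm_eq_one hX).1 hXu, fun P => ?_⟩
    rw [add_sub_cancel_left, mem_hyperplaneWithFoot_iff_inner_smul_vsub he hX]

end FocalConic

section PedalCircle

variable {A B D P X : Plane} {E : Sphere Plane} {T : Affine.Triangle ℝ Plane} {γ : Conic}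
  {ℓ : AffineSubspace ℝ Plane}

instance fact_finrank_plane : Fact (Module.finrank ℝ Plane = 2) :=
  ⟨finrank_euclideanSpace_fin⟩

theorem footOn_comm (D A B : Plane) : footOn D A B = footOn D B A := by
  rw [footOn, footOn]
  congr! 2
  rw [Set.pair_comm]

theorem footOn_eq_iff (hAB : A ≠ B) (hX : X ≠ D) :
    footOn D A B = X ↔ line[ℝ, A, B] = hyperplaneWithFoot D X := by
  rw [footOn, coe_orthogonalProjection_eq_iff_mem]
  constructor
  · rintro ⟨hXmem, horth⟩
    have hmem {Q : Plane} (hQ : Q ∈ line[ℝ, A, B]) : Q ∈ hyperplaneWithFoot D X := by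
      rw [mem_hyperplaneWithFoot, ← neg_vsub_eq_vsub_rev, inner_neg_left, neg_eq_zero]
      exact Submodule.inner_left_of_mem_orthogonal
        (AffineSubspace.vsub_mem_direction hQ hXmem) horth
    exact line_eq_hyperplaneWithFoot hX hAB (hmem (left_mem_affineSpan_pair ℝ A B))
      (hmem (right_mem_affineSpan_pair ℝ A B))
  · intro h
    rw [h]
    refine ⟨self_mem_hyperplaneWithFoot D X, ?_⟩
    rw [hyperplaneWithFoot, Sphere.direction_orthRadius, ← neg_vsub_eq_vsub_rev X D, neg_mem_iff]
    exact Submodule.le_orthogonal_orthogonal _ (Submodule.mem_span_singleton_self _)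

theorem footOn_mem_iff_exists (hAB : A ≠ B) (hD : D ∉ E) :
    footOn D A B ∈ E ↔ ∃ X ∈ E, line[ℝ, A, B] = hyperplaneWithFoot D X := by
  constructor
  · intro h
    exact ⟨_, h, (footOn_eq_iff hAB (ne_of_mem_of_not_mem h hD)).1 rfl⟩
  · rintro ⟨X, hX, h⟩
    rwa [(footOn_eq_iff hAB (ne_of_mem_of_not_mem hX hD)).2 h]

theorem footOn_mem_of_mem_hyperplaneWithFoot (hAB : A ≠ B) (hD : D ∉ E) (hX : X ∈ E)
    (hA : A ∈ hyperplaneWithFoot D X) (hB : B ∈ hyperplaneWithFoot D X) : footOn D A B ∈ E :=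
  (footOn_mem_iff_exists hAB hD).2
    ⟨X, hX, line_eq_hyperplaneWithFoot (ne_of_mem_of_not_mem hX hD) hAB hA hB⟩

theorem points_add_one_ne_add_two (T : Affine.Triangle ℝ Plane) (i : Fin 3) :
    T.points (i + 1) ≠ T.points (i + 2) :=
  T.independent.injective.ne (by revert i; decide)

theorem points_mem_sideLine {i j : Fin 3} (T : Affine.Triangle ℝ Plane) (hij : i ≠ j) :
    T.points i ∈ sideLine T j := by
  have : i = j + 1 ∨ i = j + 2 := by revert i j; decide
  rcases this with rfl | rfl
  · exact left_mem_affineSpan_pair ℝ _ _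
  · exact right_mem_affineSpan_pair ℝ _ _

theorem points_notMem_sideLine (T : Affine.Triangle ℝ Plane) (i : Fin 3) :
    T.points i ∉ sideLine T i := by
  have hne : i ≠ i + 1 ∧ i ≠ i + 2 ∧ i + 1 ≠ i + 2 := by revert i; decide
  exact fun h => (affineIndependent_iff_not_collinear_of_ne hne.1 hne.2.1 hne.2.2).1 T.independent
    (collinear_insert_of_mem_affineSpan_pair h)

theorem sideLine_eq_hyperplaneWithFoot (hD : D ∉ E) {i : Fin 3} (h : pedalPoints D T i ∈ E) :
    sideLine T i = hyperplaneWithFoot D (pedalPoints D T i) :=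
  (footOn_eq_iff (points_add_one_ne_add_two T i) (ne_of_mem_of_not_mem h hD)).1 rfl

theorem circumsphere_eq_of_forall_mem (hT : ∀ i, T.points i ∈ E) : T.circumsphere = E := by
  symm
  apply T.circumsphere_unique_dist_eq.2
  refine ⟨?_, by rintro _ ⟨i, rfl⟩; exact hT i⟩
  rw [T.independent.affineSpan_eq_top_iff_card_eq_finrank_add_one.2 (by simp)]
  exact AffineSubspace.mem_top _ _ _

theorem isPedalCircle_iff (hD : D ∉ E) : IsPedalCircle D T E ↔ ∀ i, pedalPoints D T i ∈ E := by
  constructor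
  · rintro ⟨h, rfl⟩ i
    exact (Affine.Simplex.mk (n := 2) (pedalPoints D T) h).mem_circumsphere i
  · intro h
    have hinj : Function.Injective (pedalPoints D T) := by
      intro i j hij
      by_contra hne
      have hside : sideLine T i = sideLine T j := by
        rw [sideLine_eq_hyperplaneWithFoot hD (h i), sideLine_eq_hyperplaneWithFoot hD (h j), hij]
      exact points_notMem_sideLine T i (hside ▸ points_mem_sideLine T hne)
    exact ⟨E.cospherical.affineIndependent (by rintro _ ⟨i, rfl⟩; exact h i) hinj,
      circumsphere_eq_of_forall_mem h⟩

theorem IsPedalCircle.radius_pos (h : IsPedalCircle D T E) : 0 < E.radius := by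
  obtain ⟨hind, rfl⟩ := h
  exact Affine.Simplex.circumradius_pos _

/-- The conic with focus `D` whose pedal curve with respect to `D` is the circle `E`. -/
noncomputable def pedalConic (D : Plane) (E : Sphere Plane) (hr : 0 < E.radius) (hD : D ∉ E) :
    Conic :=
  focalConic D (E.radius⁻¹ • (D -ᵥ E.center)) (E.power D / E.radius)
    (div_ne_zero ((Sphere.power_eq_zero_iff_mem_sphere hr.le).not.2 hD) hr.ne')

theorem isTangentLine_pedalConic_iff (hr : 0 < E.radius) (hD : D ∉ E)
    (hℓ : (ℓ : Set Plane).Nonempty) :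
    (pedalConic D E hr hD).IsTangentLine ℓ ↔ ∃ X ∈ E, ℓ = hyperplaneWithFoot D X := by
  simp only [pedalConic, isTangentLine_focalConic_iff _ hℓ, mem_pedalCurve_iff_mem_sphere hr hD]

theorem isTangentLine_pedalConic_line_iff (hr : 0 < E.radius) (hD : D ∉ E) (hAB : A ≠ B) :
    (pedalConic D E hr hD).IsTangentLine line[ℝ, A, B] ↔ footOn D A B ∈ E := by
  rw [isTangentLine_pedalConic_iff hr hD ⟨A, left_mem_affineSpan_pair ℝ A B⟩,
    footOn_mem_iff_exists hAB hD]

theorem isCircumscribedTo_pedalConic_iff (hr : 0 < E.radius) (hD : D ∉ E) :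
    IsCircumscribedTo T (pedalConic D E hr hD) ↔ IsPedalCircle D T E := by
  rw [isPedalCircle_iff hD]
  exact forall_congr' fun i =>
    isTangentLine_pedalConic_line_iff hr hD (points_add_one_ne_add_two T i)

theorem isInconicWithFocus_pedalConic (hE : IsPedalCircle D T E) (hD : D ∉ E) :
    IsInconicWithFocus (pedalConic D E hE.radius_pos hD) T D :=
  ⟨Conic.isFocus_iff_exists_same.2 ⟨_, _, _, 1, one_ne_zero, (one_smul ℝ _).symm⟩,
    (isCircumscribedTo_pedalConic_iff _ hD).2 hE⟩

theorem pedalConic_same_of_isInconicWithFocus (hE : IsPedalCircle D T E) (hD : D ∉ E)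
    (hγ : IsInconicWithFocus γ T D) : (pedalConic D E hE.radius_pos hD).Same γ := by
  obtain ⟨u, e, he, hsame⟩ := Conic.isFocus_iff_exists_same.1 hγ.1
  have hfeet := (isPedalCircle_iff hD).1 hE
  have hcurve : Set.range (pedalPoints D T) ⊆ pedalCurve D u e := by
    rintro _ ⟨i, rfl⟩
    have hAB := points_add_one_ne_add_two T i
    obtain ⟨X, hX, hline⟩ := (isTangentLine_focalConic_iff he
      ⟨_, left_mem_affineSpan_pair ℝ _ _⟩).1 (hsame.isTangentLine_iff.1 (hγ.2 i))
    rwa [pedalPoints, (footOn_eq_iff hAB (ne_of_mem_pedalCurve he hX)).2 hline]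
  have hspan : affineSpan ℝ (Set.range (pedalPoints D T)) = ⊤ :=
    hE.1.affineSpan_eq_top_iff_card_eq_finrank_add_one.2 (by simp)
  obtain ⟨rfl, rfl⟩ | ⟨rfl, rfl⟩ := eq_or_eq_neg_of_subset_pedalCurve hspan
    (by rintro _ ⟨i, rfl⟩; exact hfeet i) hcurve he
  · exact hsame
  · rwa [focalConic_neg] at hsame

theorem mem_ofDiameter_points_pedalPoints (hD : D ∉ E) {i j : Fin 3} (hij : i ≠ j)
    (h : pedalPoints D T j ∈ E) : pedalPoints D T j ∈ Sphere.ofDiameter (T.points i) D := by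
  rw [mem_ofDiameter_iff_mem_hyperplaneWithFoot, ← sideLine_eq_hyperplaneWithFoot hD h]
  exact points_mem_sideLine T hij

theorem lineFrom_eq_hyperplaneWithFoot (hX : X ∈ Sphere.ofDiameter P D) (hXD : X ≠ D) :
    lineFrom D P X = hyperplaneWithFoot D X := by
  rw [lineFrom]
  split_ifs with h
  · rw [h, orthRadius_ofDiameter_left]
  · exact line_eq_hyperplaneWithFoot hXD (Ne.symm h)
      (mem_ofDiameter_iff_mem_hyperplaneWithFoot.1 hX) (self_mem_hyperplaneWithFoot D X)

end PedalCircle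

section Porism

variable {D P Q R X Y : Plane} {C E : Sphere Plane} {T : Affine.Triangle ℝ Plane}

/-- Two chords of the circle `C` with a common endpoint on which `D` has its feet on `E` are two
sides of a triangle whose third side has the same property. -/
def PedalChordsClose (C E : Sphere Plane) (D : Plane) : Prop :=
  ∀ ⦃P Q R : Plane⦄, P ∈ C → Q ∈ C → R ∈ C → P ≠ Q → P ≠ R → Q ≠ R →
    footOn D P Q ∈ E → footOn D P R ∈ E → footOn D Q R ∈ E

theorem PedalChordsClose.exists_triangle (hclose : PedalChordsClose C E D) (hD : D ∉ E)
    (hP : P ∈ C) (hQ : Q ∈ C) (hR : R ∈ C) (hX : X ∈ E) (hY : Y ∈ E) (hXY : X ≠ Y)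
    (hPX : P ∈ hyperplaneWithFoot D X) (hPY : P ∈ hyperplaneWithFoot D Y)
    (hQX : Q ∈ hyperplaneWithFoot D X) (hRY : R ∈ hyperplaneWithFoot D Y)
    (hQP : Q ≠ P) (hRP : R ≠ P) :
    ∃ T : Affine.Triangle ℝ Plane, T.points = ![P, Q, R] ∧ IsInscribedIn T C ∧
      IsPedalCircle D T E := by
  have hQR : Q ≠ R := by
    rintro rfl
    refine hXY (hyperplaneWithFoot_injective D ?_)
    rw [← line_eq_hyperplaneWithFoot (ne_of_mem_of_not_mem hX hD) hQP hQX hPX,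
      line_eq_hyperplaneWithFoot (ne_of_mem_of_not_mem hY hD) hQP hRY hPY]
  have hfPQ := footOn_mem_of_mem_hyperplaneWithFoot hQP.symm hD hX hPX hQX
  have hfRP := footOn_mem_of_mem_hyperplaneWithFoot hRP hD hY hRY hPY
  have hfQR := hclose hP hQ hR hQP.symm hRP.symm hQR hfPQ (footOn_comm D R P ▸ hfRP)
  refine ⟨⟨![P, Q, R], C.cospherical.affineIndependent_of_mem_of_ne hP hQ hR
    hQP.symm hRP.symm hQR⟩, rfl, ?_, (isPedalCircle_iff hD).2 ?_⟩
  · intro i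
    fin_cases i
    exacts [hP, hQ, hR]
  · intro i
    fin_cases i
    exacts [hfQR, hfRP, hfPQ]

theorem PedalChordsClose.isPonceletPairThree (hclose : PedalChordsClose C E D)
    (hT : IsInscribedIn T C) (hE : IsPedalCircle D T E) (hD : D ∉ E) :
    IsPonceletPairThree C (pedalConic D E hE.radius_pos hD) := by
  refine ⟨⟨T, hT, (isCircumscribedTo_pedalConic_iff _ hD).2 hE⟩, ?_⟩
  intro P Q R ℓ₁ ℓ₂ hP hQ hR h₁ h₂ hne hP₁ hP₂ hQ₁ hR₂ hQP hRP
  obtain ⟨X, hX, rfl⟩ := (isTangentLine_pedalConic_iff _ hD ⟨P, hP₁⟩).1 h₁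
  obtain ⟨Y, hY, rfl⟩ := (isTangentLine_pedalConic_iff _ hD ⟨P, hP₂⟩).1 h₂
  obtain ⟨T', hpoints, -, hT'⟩ := hclose.exists_triangle hD hP hQ hR hX hY
    (ne_of_apply_ne _ hne) hP₁ hP₂ hQ₁ hR₂ hQP hRP
  exact ⟨T', hpoints, (isCircumscribedTo_pedalConic_iff _ hD).2 hT'⟩

theorem IsPedalConstruction.exists_triangle (h : IsPedalConstruction C E D P Q R)
    (hclose : PedalChordsClose C E D) (hD : D ∉ E) :
    ∃ T : Affine.Triangle ℝ Plane, T.points = ![P, Q, R] ∧ IsInscribedIn T C ∧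
      IsPedalCircle D T E := by
  obtain ⟨hP, X, Y, hXY, hX, hPX, hY, hPY, hQ, hQP, hQX, hR, hRP, hRY⟩ := h
  rw [lineFrom_eq_hyperplaneWithFoot hPX (ne_of_mem_of_not_mem hX hD)] at hQX
  rw [lineFrom_eq_hyperplaneWithFoot hPY (ne_of_mem_of_not_mem hY hD)] at hRY
  rw [mem_ofDiameter_iff_mem_hyperplaneWithFoot] at hPX hPY
  exact hclose.exists_triangle hD hP hQ hR hX hY hXY hPX hPY hQX hRY hQP hRP

theorem IsPedalCircle.isPedalConstruction (hE : IsPedalCircle D T E) (hD : D ∉ E)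
    (hT : IsInscribedIn T C) :
    IsPedalConstruction C E D (T.points 0) (T.points 1) (T.points 2) := by
  have hfeet := (isPedalCircle_iff hD).1 hE
  have hdiam (i j : Fin 3) (hij : i ≠ j) := mem_ofDiameter_points_pedalPoints hD hij (hfeet j)
  have hline (i j : Fin 3) (hij : i ≠ j) :
      lineFrom D (T.points i) (pedalPoints D T j) = sideLine T j := by
    rw [lineFrom_eq_hyperplaneWithFoot (hdiam i j hij) (ne_of_mem_of_not_mem (hfeet j) hD),
      sideLine_eq_hyperplaneWithFoot hD (hfeet j)]
  refine ⟨hT 0, pedalPoints D T 2, pedalPoints D T 1, hE.1.injective.ne (by decide),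
    hfeet 2, hdiam 0 2 (by decide), hfeet 1, hdiam 0 1 (by decide),
    hT 1, T.independent.injective.ne (by decide), ?_,
    hT 2, T.independent.injective.ne (by decide), ?_⟩
  · rw [hline 0 2 (by decide)]
    exact points_mem_sideLine T (by decide)
  · rw [hline 0 1 (by decide)]
    exact points_mem_sideLine T (by decide)

end Porism

section Blaschke

variable {d μ x y z : ℂ}

theorem mul_conj_eq_one (hz : ‖z‖ = 1) : z * conj z = 1 := by
  rw [Complex.mul_conj', hz, Complex.ofReal_one, one_pow]

theorem norm_eq_norm_iff_mul_conj_eq : ‖x‖ = ‖y‖ ↔ x * conj x = y * conj y := by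
  rw [Complex.mul_conj', Complex.mul_conj', ← sq_eq_sq₀ (norm_nonneg x) (norm_nonneg y)]
  norm_cast

theorem one_sub_conj_mul_ne_zero (hd : ‖d‖ ≠ 1) (hz : ‖z‖ = 1) : 1 - conj d * z ≠ 0 := by
  intro h
  have hnorm := congrArg norm (sub_eq_zero.1 h)
  rw [norm_one, norm_mul, Complex.norm_conj, hz, mul_one] at hnorm
  exact hd hnorm.symm

theorem norm_sub_eq_norm_one_sub_conj_mul_iff :
    ‖d - μ‖ = ‖1 - conj d * μ‖ ↔ ‖d‖ = 1 ∨ ‖μ‖ = 1 := by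
  rw [← norm_one (α := ℂ), norm_eq_norm_iff_mul_conj_eq, norm_eq_norm_iff_mul_conj_eq,
    norm_eq_norm_iff_mul_conj_eq, ← sub_eq_zero, ← sub_eq_zero (a := d * conj d),
    ← sub_eq_zero (a := μ * conj μ), ← mul_eq_zero]
  simp only [map_sub, map_mul, map_one, Complex.conj_conj]
  constructor <;> intro h <;> linear_combination -h

/-- The Blaschke product of degree three with zeros `0`, `d` and `μ`. -/
noncomputable def blaschke (d μ z : ℂ) : ℂ :=
  z * (z - d) * (z - μ) / ((1 - conj d * z) * (1 - conj μ * z))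

theorem blaschke_eq_iff (hd : ‖d‖ ≠ 1) (hμ : ‖μ‖ ≠ 1) (hx : ‖x‖ = 1) (hy : ‖y‖ = 1)
    (hxy : x ≠ y) :
    blaschke d μ x = blaschke d μ y ↔
      (x + y - x * y * conj d - μ) * (x + y - d - x * y * conj μ) =
        (1 - conj d * μ) * (1 - d * conj μ) * (x * y) := by
  have hden {w : ℂ} (hw : ‖w‖ = 1) : (1 - conj d * w) * (1 - conj μ * w) ≠ 0 :=
    mul_ne_zero (one_sub_conj_mul_ne_zero hd hw) (one_sub_conj_mul_ne_zero hμ hw)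
  rw [blaschke, blaschke, div_eq_div_iff (hden hx) (hden hy)]
  refine ⟨fun h => mul_left_cancel₀ (sub_ne_zero.2 hxy) ?_, fun h => ?_⟩
  · linear_combination h
  · linear_combination (x - y) * h

theorem norm_sub_eq_iff_blaschke_eq (hd : ‖d‖ ≠ 1) (hμ : ‖μ‖ ≠ 1) (hx : ‖x‖ = 1) (hy : ‖y‖ = 1)
    (hxy : x ≠ y) :
    ‖x + y - x * y * conj d - μ‖ = ‖1 - conj d * μ‖ ↔ blaschke d μ x = blaschke d μ y := by
  have hx' := mul_conj_eq_one hx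
  have hy' := mul_conj_eq_one hy
  have hne : x * y ≠ 0 := mul_ne_zero (left_ne_zero_of_mul_eq_one hx')
    (left_ne_zero_of_mul_eq_one hy')
  have hconj : conj (x + y - x * y * conj d - μ) * (x * y) = x + y - d - x * y * conj μ := by
    simp only [map_sub, map_add, map_mul, Complex.conj_conj]
    linear_combination (y - d * y * conj y) * hx' + (x - d) * hy'
  rw [blaschke_eq_iff hd hμ hx hy hxy, ← hconj, norm_eq_norm_iff_mul_conj_eq]
  simp only [map_sub (starRingEnd ℂ) 1, map_one, map_mul (starRingEnd ℂ) (conj d),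
    Complex.conj_conj]
  refine ⟨fun h => ?_, fun h => mul_right_cancel₀ hne ?_⟩
  · linear_combination x * y * h
  · linear_combination h

/-- The points `d` and `μ` are isogonally conjugate with respect to the triangle `xyz` inscribed in
the unit circle, expressed by Morley's equation. -/
def IsIsogonalPair (d μ x y z : ℂ) : Prop :=
  x + y + z = d + μ + conj d * conj μ * (x * y * z)

theorem IsIsogonalPair.rotate (h : IsIsogonalPair d μ x y z) : IsIsogonalPair d μ y z x := by
  rw [IsIsogonalPair] at h ⊢
  linear_combination h

theorem exists_add_mul_conj_eq {p : ℂ} (hp : ‖p‖ ≠ 1) (q : ℂ) : ∃ w, w + p * conj w = q := by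
  have hp' : 1 - p * conj p ≠ 0 := by
    rw [sub_ne_zero, Complex.mul_conj', ne_comm]
    exact_mod_cast (pow_eq_one_iff_of_nonneg (norm_nonneg p) two_ne_zero).not.2 hp
  refine ⟨(q - p * conj q) / (1 - p * conj p), ?_⟩
  simp only [map_div₀, map_sub, map_one, map_mul, Complex.conj_conj, mul_comm (conj p) p]
  field_simp
  ring

theorem exists_isIsogonalPair (hd : ‖d‖ ≠ 1) (hx : ‖x‖ = 1) (hy : ‖y‖ = 1) (hz : ‖z‖ = 1) :
    ∃ μ, IsIsogonalPair d μ x y z := by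
  obtain ⟨μ, hμ⟩ := exists_add_mul_conj_eq (p := conj d * (x * y * z))
    (by simpa [hx, hy, hz] using hd) (x + y + z - d)
  exact ⟨μ, by rw [IsIsogonalPair]; linear_combination -hμ⟩

theorem IsIsogonalPair.mul_add_mul_add_mul_eq (h : IsIsogonalPair d μ x y z) (hx : ‖x‖ = 1)
    (hy : ‖y‖ = 1) (hz : ‖z‖ = 1) :
    x * y + y * z + z * x = (conj d + conj μ) * (x * y * z) + d * μ := by
  have hx' := mul_conj_eq_one hx
  have hy' := mul_conj_eq_one hy
  have hz' := mul_conj_eq_one hz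
  have hxyz : x * y * z * (conj x * conj y * conj z) = 1 := by
    linear_combination y * z * conj y * conj z * hx' + z * conj z * hy' + hz'
  have hconj := congrArg conj h
  simp only [map_add, map_mul, Complex.conj_conj] at hconj
  linear_combination (x * y * z) * hconj + d * μ * hxyz - y * z * hx' - x * z * hy' - x * y * hz'

theorem IsIsogonalPair.sub_mul_sub_eq (h : IsIsogonalPair d μ x y z) (hx : ‖x‖ = 1) (hy : ‖y‖ = 1)
    (hz : ‖z‖ = 1) :
    (x - d) * (x - μ) = y * z * ((1 - conj d * x) * (1 - conj μ * x)) := by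
  have hconj := h.mul_add_mul_add_mul_eq hx hy hz
  rw [IsIsogonalPair] at h
  refine mul_left_cancel₀ (left_ne_zero_of_mul_eq_one (mul_conj_eq_one hx)) ?_
  linear_combination x ^ 2 * h - x * hconj

theorem IsIsogonalPair.blaschke_eq (h : IsIsogonalPair d μ x y z) (hd : ‖d‖ ≠ 1) (hμ : ‖μ‖ ≠ 1)
    (hx : ‖x‖ = 1) (hy : ‖y‖ = 1) (hz : ‖z‖ = 1) : blaschke d μ x = x * y * z := by
  rw [blaschke, div_eq_iff (mul_ne_zero (one_sub_conj_mul_ne_zero hd hx)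
    (one_sub_conj_mul_ne_zero hμ hx))]
  linear_combination x * h.sub_mul_sub_eq hx hy hz

theorem IsIsogonalPair.ne_of_norm_eq_one (h : IsIsogonalPair d μ x y z) (hμ : ‖μ‖ = 1)
    (hyz : y + z ≠ d + y * z * conj d) : μ ≠ x := by
  rintro rfl
  rw [IsIsogonalPair] at h
  exact hyz (by linear_combination h + conj d * y * z * mul_conj_eq_one hμ)

theorem IsIsogonalPair.norm_ne_one (h : IsIsogonalPair d μ x y z) (hx : ‖x‖ = 1) (hy : ‖y‖ = 1)
    (hz : ‖z‖ = 1) (hyz : y + z ≠ d + y * z * conj d) (hzx : z + x ≠ d + z * x * conj d)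
    (hxy : x + y ≠ d + x * y * conj d) : ‖μ‖ ≠ 1 := by
  intro hμ
  have hprod : (μ - x) * (μ - y) * (μ - z) = 0 := by
    have hsum : x + y + z = d + μ + conj d * conj μ * (x * y * z) := h
    linear_combination -μ ^ 2 * hsum + μ * h.mul_add_mul_add_mul_eq hx hy hz +
      x * y * z * (1 - conj d * μ) * mul_conj_eq_one hμ
  have hμx := sub_ne_zero.2 (h.ne_of_norm_eq_one hμ hyz)
  have hμy := sub_ne_zero.2 (h.rotate.ne_of_norm_eq_one hμ hzx)
  have hμz := sub_ne_zero.2 (h.rotate.rotate.ne_of_norm_eq_one hμ hxy)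
  exact mul_ne_zero (mul_ne_zero hμx hμy) hμz hprod

theorem exists_blaschke_eq (hd : ‖d‖ ≠ 1) (hx : ‖x‖ = 1) (hy : ‖y‖ = 1) (hz : ‖z‖ = 1)
    (hyz : y + z ≠ d + y * z * conj d) (hzx : z + x ≠ d + z * x * conj d)
    (hxy : x + y ≠ d + x * y * conj d) :
    ∃ μ, ‖μ‖ ≠ 1 ∧ blaschke d μ x = blaschke d μ y ∧ blaschke d μ y = blaschke d μ z := by
  obtain ⟨μ, h⟩ := exists_isIsogonalPair hd hx hy hz
  have hμ := h.norm_ne_one hx hy hz hyz hzx hxy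
  refine ⟨μ, hμ, ?_, ?_⟩
  · rw [h.blaschke_eq hd hμ hx hy hz, h.rotate.blaschke_eq hd hμ hy hz hx]
    ring
  · rw [h.rotate.blaschke_eq hd hμ hy hz hx, h.rotate.rotate.blaschke_eq hd hμ hz hx hy]
    ring

end Blaschke

section CircleCoord

variable {A B D P : Plane} {C : Sphere Plane}

/-- The complex coordinate of the plane in which `C` is the unit circle. -/
noncomputable def circleCoord (C : Sphere Plane) (P : Plane) : ℂ :=
  C.radius⁻¹ • Complex.orthonormalBasisOneI.repr.symm (P -ᵥ C.center)

theorem circleCoord_sub (C : Sphere Plane) (A B : Plane) :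
    circleCoord C A - circleCoord C B =
      C.radius⁻¹ • Complex.orthonormalBasisOneI.repr.symm (A -ᵥ B) := by
  rw [circleCoord, circleCoord, ← smul_sub, ← map_sub, vsub_sub_vsub_cancel_right]

theorem circleCoord_center (C : Sphere Plane) : circleCoord C C.center = 0 := by
  rw [circleCoord, vsub_self, map_zero, smul_zero]

theorem norm_circleCoord_sub (hr : 0 < C.radius) (A B : Plane) :
    ‖circleCoord C A - circleCoord C B‖ = dist A B / C.radius := by
  rw [circleCoord_sub, norm_smul, LinearIsometryEquiv.norm_map, norm_inv,
    Real.norm_of_nonneg hr.le, dist_eq_norm_vsub Plane, div_eq_inv_mul]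

theorem norm_circleCoord_eq_one_iff (hr : 0 < C.radius) : ‖circleCoord C P‖ = 1 ↔ P ∈ C := by
  rw [← sub_zero (circleCoord C P), ← circleCoord_center C, norm_circleCoord_sub hr,
    div_eq_one_iff_eq hr.ne', mem_sphere]

theorem circleCoord_injective (hr : 0 < C.radius) : Function.Injective (circleCoord C) := by
  intro A B h
  rw [← sub_eq_zero, ← norm_eq_zero, norm_circleCoord_sub hr] at h
  simpa [hr.ne'] using h

theorem circleCoord_surjective (hr : 0 < C.radius) : Function.Surjective (circleCoord C) := by
  intro w
  refine ⟨Complex.orthonormalBasisOneI.repr (C.radius • w) +ᵥ C.center, ?_⟩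
  rw [circleCoord, vadd_vsub, LinearIsometryEquiv.symm_apply_apply, inv_smul_smul₀ hr.ne']

theorem exists_mem_sphere_iff_norm_circleCoord_sub_eq (hr : 0 < C.radius) (w : ℂ) (ρ : ℝ) :
    ∃ E : Sphere Plane, ∀ P, P ∈ E ↔ ‖circleCoord C P - w‖ = ρ := by
  obtain ⟨O, rfl⟩ := circleCoord_surjective hr w
  refine ⟨⟨O, ρ * C.radius⟩, fun P => ?_⟩
  rw [mem_sphere, norm_circleCoord_sub hr, div_eq_iff hr.ne']

theorem circleCoord_add_mul_conj_of_mem_line (hr : 0 < C.radius) (hA : A ∈ C) (hB : B ∈ C)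
    (hP : P ∈ line[ℝ, A, B]) :
    circleCoord C P + circleCoord C A * circleCoord C B * conj (circleCoord C P) =
      circleCoord C A + circleCoord C B := by
  obtain ⟨t, rfl⟩ := mem_affineSpan_pair_iff_exists_lineMap_eq.1 hP
  have ha := mul_conj_eq_one ((norm_circleCoord_eq_one_iff hr).2 hA)
  have hb := mul_conj_eq_one ((norm_circleCoord_eq_one_iff hr).2 hB)
  have hsub := circleCoord_sub C (AffineMap.lineMap A B t) A
  rw [AffineMap.lineMap_vsub_left, map_smul, smul_comm, ← circleCoord_sub,
    sub_eq_iff_eq_add] at hsub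
  rw [hsub]
  simp only [Complex.real_smul, map_add, map_mul, map_sub, Complex.conj_ofReal]
  linear_combination (1 - t) * circleCoord C B * ha + t * circleCoord C A * hb

theorem circleCoord_sub_eq_mul_conj_of_inner_eq_zero (hr : 0 < C.radius) (hA : A ∈ C) (hB : B ∈ C)
    (hAB : A ≠ B) (h : ⟪P -ᵥ D, B -ᵥ A⟫ = 0) :
    circleCoord C P - circleCoord C D =
      circleCoord C A * circleCoord C B * conj (circleCoord C P - circleCoord C D) := by
  have ha := mul_conj_eq_one ((norm_circleCoord_eq_one_iff hr).2 hA)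
  have hb := mul_conj_eq_one ((norm_circleCoord_eq_one_iff hr).2 hB)
  have hinner : ⟪circleCoord C P - circleCoord C D, circleCoord C B - circleCoord C A⟫ = 0 := by
    rw [circleCoord_sub, circleCoord_sub, real_inner_smul_left, real_inner_smul_right,
      LinearIsometryEquiv.inner_map_map, h, mul_zero, mul_zero]
  have hre := congrArg ((↑) : ℝ → ℂ) hinner
  rw [Complex.inner, Complex.re_eq_add_conj, Complex.ofReal_zero] at hre
  simp only [map_mul, map_sub, Complex.conj_conj] at hre ⊢
  refine mul_left_cancel₀ (sub_ne_zero.2 ((circleCoord_injective hr).ne hAB)) ?_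
  set a := circleCoord C A
  set b := circleCoord C B
  set p := circleCoord C P
  set d := circleCoord C D
  linear_combination 2 * a * b * hre + (p - d) * b * ha - (p - d) * a * hb

theorem two_mul_circleCoord_footOn (hr : 0 < C.radius) (hA : A ∈ C) (hB : B ∈ C) (hAB : A ≠ B)
    (D : Plane) :
    2 * circleCoord C (footOn D A B) = circleCoord C D + circleCoord C A + circleCoord C B -
      circleCoord C A * circleCoord C B * conj (circleCoord C D) := by
  obtain ⟨hmem, horth⟩ := coe_orthogonalProjection_eq_iff_mem.1 (rfl : footOn D A B = footOn D A B)
  have hline := circleCoord_add_mul_conj_of_mem_line hr hA hB hmem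
  have hperp : ⟪footOn D A B -ᵥ D, B -ᵥ A⟫ = 0 := by
    rw [← neg_vsub_eq_vsub_rev, inner_neg_left, neg_eq_zero]
    exact Submodule.inner_left_of_mem_orthogonal (AffineSubspace.vsub_mem_direction
      (right_mem_affineSpan_pair ℝ A B) (left_mem_affineSpan_pair ℝ A B)) horth
  have hsub := circleCoord_sub_eq_mul_conj_of_inner_eq_zero hr hA hB hAB hperp
  rw [map_sub] at hsub
  linear_combination hline + hsub

theorem circleCoord_add_ne_of_notMem_line (hr : 0 < C.radius) (hA : A ∈ C) (hB : B ∈ C)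
    (hAB : A ≠ B) (hD : D ∉ line[ℝ, A, B]) :
    circleCoord C A + circleCoord C B ≠
      circleCoord C D + circleCoord C A * circleCoord C B * conj (circleCoord C D) := by
  intro h
  have hfoot : footOn D A B = D := circleCoord_injective hr <| by
    linear_combination (two_mul_circleCoord_footOn hr hA hB hAB D) / 2 + h / 2
  exact hD (hfoot ▸ orthogonalProjection_mem D)

theorem exists_sphere_footOn_mem_iff_blaschke_eq (hr : 0 < C.radius) (hD : D ∉ C) {μ : ℂ}
    (hμ : ‖μ‖ ≠ 1) :
    ∃ E : Sphere Plane, D ∉ E ∧ ∀ A B, A ∈ C → B ∈ C → A ≠ B →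
      (footOn D A B ∈ E ↔ blaschke (circleCoord C D) μ (circleCoord C A) =
        blaschke (circleCoord C D) μ (circleCoord C B)) := by
  set d := circleCoord C D
  have hd : ‖d‖ ≠ 1 := (norm_circleCoord_eq_one_iff hr).not.2 hD
  obtain ⟨E, hE⟩ := exists_mem_sphere_iff_norm_circleCoord_sub_eq hr ((d + μ) / 2)
    (‖1 - conj d * μ‖ / 2)
  have hmem (P : Plane) (w : ℂ) (hw : 2 * circleCoord C P = d + w) :
      P ∈ E ↔ ‖w - μ‖ = ‖1 - conj d * μ‖ := by
    have hhalf : circleCoord C P - (d + μ) / 2 = (w - μ) / 2 := by linear_combination hw / 2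
    rw [hE, hhalf, norm_div, Complex.norm_two, div_left_inj' two_ne_zero]
  refine ⟨E, ?_, fun A B hA hB hAB => ?_⟩
  · rw [hmem D d (two_mul _), norm_sub_eq_norm_one_sub_conj_mul_iff]
    exact not_or_intro hd hμ
  · rw [hmem _ (circleCoord C A + circleCoord C B - circleCoord C A * circleCoord C B * conj d)
        (by rw [two_mul_circleCoord_footOn hr hA hB hAB]; ring),
      ← norm_sub_eq_iff_blaschke_eq hd hμ ((norm_circleCoord_eq_one_iff hr).2 hA)
        ((norm_circleCoord_eq_one_iff hr).2 hB) ((circleCoord_injective hr).ne hAB)]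

theorem exists_pedalCircle_pedalChordsClose (T : Affine.Triangle ℝ Plane)
    (hside : ∀ i, D ∉ sideLine T i) (hcirc : D ∉ T.circumsphere) :
    ∃ E, D ∉ E ∧ IsPedalCircle D T E ∧ PedalChordsClose T.circumsphere E D := by
  have hr : 0 < T.circumsphere.radius := T.circumradius_pos
  have hnorm (i : Fin 3) := (norm_circleCoord_eq_one_iff hr).2 (T.mem_circumsphere i)
  have hside' (i : Fin 3) := circleCoord_add_ne_of_notMem_line hr (T.mem_circumsphere (i + 1))
    (T.mem_circumsphere (i + 2)) (points_add_one_ne_add_two T i) (hside i)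
  obtain ⟨μ, hμ, h₀₁, h₁₂⟩ := exists_blaschke_eq ((norm_circleCoord_eq_one_iff hr).not.2 hcirc)
    (hnorm 0) (hnorm 1) (hnorm 2) (hside' 0) (hside' 1) (hside' 2)
  obtain ⟨E, hD, hfoot⟩ := exists_sphere_footOn_mem_iff_blaschke_eq hr hcirc hμ
  refine ⟨E, hD, (isPedalCircle_iff hD).2 fun i => ?_, ?_⟩
  · refine (hfoot _ _ (T.mem_circumsphere _) (T.mem_circumsphere _)
      (points_add_one_ne_add_two T i)).2 ?_
    fin_cases i
    exacts [h₁₂, (h₀₁.trans h₁₂).symm, h₀₁]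
  · intro P Q R hP hQ hR hPQ hPR hQR hfPQ hfPR
    rw [hfoot P Q hP hQ hPQ] at hfPQ
    rw [hfoot P R hP hR hPR] at hfPR
    exact (hfoot Q R hQ hR hQR).2 (hfPQ.symm.trans hfPR)

end CircleCoord

theorem mainTheorem1 (T : Affine.Triangle ℝ Plane) (D : Plane)
    (hside : ∀ i, D ∉ sideLine T i) (hcirc : D ∉ T.circumsphere) :
    ∃ (E : EuclideanGeometry.Sphere Plane) (γ : Conic),
      -- the pedal circle and the inconic with focus `D` exist, and the latter is unique
      IsPedalCircle D T E ∧
      IsInconicWithFocus γ T D ∧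
      (∀ γ' : Conic, IsInconicWithFocus γ' T D → γ.Same γ') ∧
      -- the circumcircle and the inconic are a Poncelet pair
      IsPonceletPairThree T.circumsphere γ ∧
      -- inscribed triangles share the pedal circle iff they are circumscribed to the inconic
      (∀ T' : Affine.Triangle ℝ Plane, IsInscribedIn T' T.circumsphere →
        (IsPedalCircle D T' E ↔ IsCircumscribedTo T' γ)) ∧
      -- the construction only gives such triangles
      (∀ P Q R : Plane, IsPedalConstruction T.circumsphere E D P Q R →
        γ.IsTangentLine line[ℝ, Q, R] ∧ footOn D Q R ∈ E ∧
        ∃ T' : Affine.Triangle ℝ Plane, T'.points = ![P, Q, R] ∧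
          IsInscribedIn T' T.circumsphere ∧ IsCircumscribedTo T' γ ∧ IsPedalCircle D T' E) ∧
      -- the construction gives all such triangles, from each of their vertices
      (∀ T' : Affine.Triangle ℝ Plane, IsInscribedIn T' T.circumsphere →
        IsCircumscribedTo T' γ →
        IsPedalConstruction T.circumsphere E D (T'.points 0) (T'.points 1) (T'.points 2)) := by
  obtain ⟨E, hD, hE, hclose⟩ := exists_pedalCircle_pedalChordsClose T hside hcirc
  have hcircum {T' : Affine.Triangle ℝ Plane} :
      IsCircumscribedTo T' (pedalConic D E hE.radius_pos hD) ↔ IsPedalCircle D T' E :=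
    isCircumscribedTo_pedalConic_iff hE.radius_pos hD
  refine ⟨E, pedalConic D E hE.radius_pos hD, hE, isInconicWithFocus_pedalConic hE hD,
    fun γ' hγ' => pedalConic_same_of_isInconicWithFocus hE hD hγ',
    hclose.isPonceletPairThree T.mem_circumsphere hE hD, fun T' _ => hcircum.symm, ?_,
    fun T' hT' hγ => (hcircum.1 hγ).isPedalConstruction hD hT'⟩
  intro P Q R h
  obtain ⟨T', hpoints, hT', hE'⟩ := h.exists_triangle hclose hD
  have htangent := hcircum.2 hE' 0
  have hfoot := (isPedalCircle_iff hD).1 hE' 0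
  simp only [sideLine, pedalPoints, hpoints] at htangent hfoot
  exact ⟨htangent, hfoot, T', hpoints, hT', hcircum.2 hE', hE'⟩
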